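/- **Setting.** A sample $z=(G,x,y)$ consists of a finite graph $G$ without self-loops on $n(z)$ nodes, with Laplacian $L=D-A$, node features $x_1,\dots,x_{n(z)}\in\mathbb{R}^d$, and a label $y$. A graph filter $g$ assigns to the Laplacian $L$ of each graph a real symmetric matrix $g(L)$ of the same size. Write $\mathcal N(n)=\{j: g(L)_{nj}\neq 0\}$. The single-layer universal graph encoder with $P$ moments, activation $\sigma$ and parameters $\theta=(\theta_1,\dots,\theta_P)\in(\mathbb{R}^d)^P$ is $$f(z,\theta)=\sum_{n=1}^{n(z)}\sum_{p=1}^{P}\sigma\Big(\sum_{j\in\mathcal N(n)}g(L)_{nj}\,\langle x_j^{\,p},\theta_p\rangle\Big),$$ with powers $x_j^{\,p}$ taken entrywise. For a loss $\ell(s,y)$, the sample loss is $\ell(f(z,\theta),y)$. Given a training set $S=(z_1,\dots,z_m)$, $m\ge1$, SGD with step size $\eta>0$ starts at a fixed $\theta_0$ and performs $T$ steps $\theta\leftarrow\theta-\eta\nabla_\theta\,\ell(f(z_i,\theta),y_i)$, where in each step the index $i$ is drawn independently and uniformly from $\{1,\dots,m\}$; $A_S$ is the encoder with the resulting parameters,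 and $\mathbf E_{\rm sgd}$ is the expectation over the drawn indices. **Assumptions.** The activation $\sigma$ is differentiable, $\alpha_\sigma$-Lipschitz with $\nu_\sigma$-Lipschitz derivative; for each $y$, $s\mapsto\ell(s,y)$ is differentiable, $\alpha_\ell$-Lipschitz with $\nu_\ell$-Lipschitz derivative. The samples $z_1,\dots,z_m$ are i.i.d. from a probability distribution $\mu$ that is concentrated on a set $\mathcal Z$ such that every $z\in\mathcal Z$ has: at most $N$ nodes; all eigenvalues of $g(L)$ of absolute value at most $\lambda_G^{\max}$; and normalized signals, i.e. for every node $n$ and each of the $d$ features, $\sum_{j\in\mathcal N(n)}x_{j,k}^2\le1$. Moreover $0\le\ell(f(z,\theta),y)\le C$ for all $z=(G,x,y)\in\mathcal Z$ and all parameters $\theta$ that SGD can output after $T$ iterations on a training set in $\mathcal Z^m$. Let $R(A_S)$ be the expected risk under $\mu$ and $R_{emp}(A_S)$ the average loss on $S$. **Theorem.** For all $T,d,\eta,\alpha_\ell,\nu_\ell,\alpha_\sigma,\nu_\sigma$ and $c_0>0$ there is a constant $K$, depending only on these, such that, in the setting above, whenever $N(\lambda_G^{\max})^2\ge c_0$ and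 $\delta\in(0,1)$, with probability at least $1-\delta$ over $S$, $$\mathbf E_{\rm sgd}[R(A_S)]\le \mathbf E_{\rm sgd}[R_{emp}(A_S)]+K\,P\,N^{T+1}(\lambda_G^{\max})^{2T}\Big(\frac1m+\sqrt{\frac{\log\frac1\delta}{2m}}\Big)+C\sqrt{\frac{\log\frac1\delta}{2m}} .$$ -/

import Mathlib

open scoped NNReal

noncomputable section

/-- A differentiable real function that is `α`-Lipschitz and whose derivative is `ν`-Lipschitz. -/
structure IsLipschitzSmooth (α ν : ℝ≥0) (h : ℝ → ℝ) : Prop where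
  differentiable : Differentiable ℝ h
  lipschitz : LipschitzWith α h
  lipschitz_deriv : LipschitzWith ν (deriv h)

/-- A labelled graph sample: the number `n` of nodes, a graph on `n` nodes without self-loops,
the node features (`d` real features for each node), and the label. -/
abbrev GraphSample (d : ℕ) (Y : Type*) : Type _ :=
  Σ n : ℕ, SimpleGraph (Fin n) × (Fin n → Fin d → ℝ) × Y

namespace GraphSample

variable {d : ℕ} {Y : Type*}

/-- The number of nodes. -/
def size (z : GraphSample d Y) : ℕ := z.1

/-- The underlying graph. -/
def graph (z : GraphSample d Y) : SimpleGraph (Fin z.size) := z.2.1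

/-- `z.feat j k` is the `k`-th feature of node `j`. -/
def feat (z : GraphSample d Y) : Fin z.size → Fin d → ℝ := z.2.2.1

/-- The label. -/
def label (z : GraphSample d Y) : Y := z.2.2.2

open Classical in
/-- The graph Laplacian `L = D - A`. -/
def laplacian (z : GraphSample d Y) : Matrix (Fin z.size) (Fin z.size) ℝ :=
  z.graph.lapMatrix ℝ

theorem laplacian_isHermitian (z : GraphSample d Y) : z.laplacian.IsHermitian := by
  classical
  exact SimpleGraph.isHermitian_lapMatrix (R := ℝ) z.graph

end GraphSample

/-- A graph convolution filter `g`: it turns the Laplacian `L` of a graph into a symmetric matrix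
`g(L)` of the same size. As `D` is the diagonal of `L` and `A = D - L`, this covers spectral
functions of `L` as well as filters such as `D^{-1/2} A D^{-1/2} + I`. -/
structure GraphFilter where
  toFun : ∀ n : ℕ, Matrix (Fin n) (Fin n) ℝ → Matrix (Fin n) (Fin n) ℝ
  isHermitian : ∀ (n : ℕ) (L : Matrix (Fin n) (Fin n) ℝ), L.IsHermitian → (toFun n L).IsHermitian

namespace GraphFilter

variable {d : ℕ} {Y : Type*}

/-- The filter matrix `g(L)` of the graph of a sample. -/
def mat (g : GraphFilter) (z : GraphSample d Y) : Matrix (Fin z.size) (Fin z.size) ℝ :=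
  g.toFun z.size z.laplacian

theorem mat_isHermitian (g : GraphFilter) (z : GraphSample d Y) : (g.mat z).IsHermitian :=
  g.isHermitian _ _ z.laplacian_isHermitian

/-- The largest absolute value of an eigenvalue of `g(L)`. -/
def lambdaMax (g : GraphFilter) (z : GraphSample d Y) : ℝ :=
  ⨆ i, |(g.mat_isHermitian z).eigenvalues i|

open Classical in
/-- The neighbourhood over which `g(L)` aggregates at node `n`: the nodes `j` with nonzero
coefficient `g(L)_{nj}`. -/
def nbhd (g : GraphFilter) (z : GraphSample d Y) (n : Fin z.size) : Finset (Fin z.size) :=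
  {j | g.mat z n j ≠ 0}

/-- The graph signals are normalized: for each feature, the signal restricted to the neighbourhood
of any node has Euclidean norm at most one. -/
def SignalNormalized (g : GraphFilter) (z : GraphSample d Y) : Prop :=
  ∀ (n : Fin z.size) (k : Fin d), ∑ j ∈ g.nbhd z n, z.feat j k ^ 2 ≤ 1

end GraphFilter

/-- The parameters: for each of the `P` moments a weight vector in `ℝ^d`. -/
abbrev EncoderParams (P d : ℕ) : Type := EuclideanSpace ℝ (Fin P × Fin d)

/-- The single-layer universal graph encoder with sum read-out,
`f(x, θ) = ∑ₙ ∑_{p=1}^P σ(∑_{j ∈ N(n)} g(L)_{nj} ⟨x_j ^ p, θ_p⟩)`, powers being entrywise.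
The `p`-th moment, `1 ≤ p ≤ P`, has index `p - 1` in `Fin P`. -/
def encoder {P d : ℕ} {Y : Type*} (g : GraphFilter) (σ : ℝ → ℝ) (θ : EncoderParams P d)
    (z : GraphSample d Y) : ℝ :=
  ∑ n, ∑ p : Fin P,
    σ (∑ j ∈ g.nbhd z n, g.mat z n j * ∑ k, z.feat j k ^ ((p : ℕ) + 1) * θ (p, k))

/-- The loss `ℓ(f(x, θ), y)` of the parameter `θ` at a sample. -/
def sampleLoss {P d : ℕ} {Y : Type*} (g : GraphFilter) (σ : ℝ → ℝ) (ℓ : ℝ → Y → ℝ)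
    (θ : EncoderParams P d) (z : GraphSample d Y) : ℝ :=
  ℓ (encoder g σ θ z) z.label

/-- The parameter after `T` iterations of SGD with step size `η`, started at `θ₀`, on the training
set `S`, when iteration `t` uses the training sample with index `ω t`. -/
def sgd {P d m : ℕ} {Y : Type*} (g : GraphFilter) (σ : ℝ → ℝ) (ℓ : ℝ → Y → ℝ) (η : ℝ)
    (θ₀ : EncoderParams P d) (S : Fin m → GraphSample d Y) :
    (T : ℕ) → (Fin T → Fin m) → EncoderParams P d
  | 0, _ => θ₀
  | t + 1, ω =>
    let θ := sgd g σ ℓ η θ₀ S t (fun i => ω i.castSucc)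
    θ - η • gradient (fun θ' => sampleLoss g σ ℓ θ' (S (ω (Fin.last t)))) θ

/-- The expectation over the randomness of SGD: the `T` indices are independent and uniformly
distributed on the `m` training samples. -/
def sgdExpectation {T m : ℕ} (h : (Fin T → Fin m) → ℝ) : ℝ :=
  (∑ ω, h ω) / (m : ℝ) ^ T

/-- The expected risk `R(θ)` under the data distribution `μ`. -/
def risk {P d : ℕ} {Y : Type*} [MeasurableSpace Y] (g : GraphFilter) (σ : ℝ → ℝ)
    (ℓ : ℝ → Y → ℝ) (μ : MeasureTheory.Measure (GraphSample d Y)) (θ : EncoderParams P d) : ℝ :=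
  ∫ z, sampleLoss g σ ℓ θ z ∂μ

/-- The empirical risk `R_emp(θ)` on the training set `S`. -/
def empiricalRisk {P d m : ℕ} {Y : Type*} (g : GraphFilter) (σ : ℝ → ℝ) (ℓ : ℝ → Y → ℝ)
    (S : Fin m → GraphSample d Y) (θ : EncoderParams P d) : ℝ :=
  (∑ i, sampleLoss g σ ℓ θ (S i)) / m

end

/-! The bound combines a stability estimate for SGD with McDiarmid's inequality.

On an admissible sample each row of `g(L)` has Euclidean norm at most `λ` and the signals, hence
their powers, are normalized, so every aggregated feature is at most `λ` by Cauchy-Schwarz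
(`GraphFilter.abs_aggregate_le`). Therefore `θ ↦ ℓ(f(z, θ), y)` is `B`-Lipschitz with
`B = α_ℓ α_σ N λ √(P d)` (`sampleLoss_sub_le`), and its gradient is bounded by `B`. Two runs of SGD
with the same indices on training sets differing in one sample agree unless that sample is drawn,
which has probability at most `T / m`, and in any case both stay within `η T B` of `θ₀`. So the
expected loss at any point differs by at most `β / m` with `β = 2 η T² B²`
(`sgd_uniformly_stable`). Here `β` is a multiple of `P N² λ²`, and for `T ≥ 1` the hypothesis
`c₀ ≤ N λ²` gives `N² λ² ≤ N (N λ²) ^ T / c₀ ^ (T - 1)`, which is the stated rate; no expansion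
estimate for the gradient steps is needed.

Uniform stability `β / m` bounds the mean of the generalization gap by `β / m`, by exchanging a
training sample with an independent one, and makes the gap a function of the samples with
differences at most `(2 β + C) / m` (`generalization_of_uniform_stability`). McDiarmid's inequality
(`mcdiarmid`) is obtained from Hoeffding's lemma by induction on the number of samples. Its use
requires the output of SGD to be a measurable function of the training set; this holds since the
gradient of the loss is continuous in the parameter and a limit of difference quotients that are
measurable in the sample (`measurable_gradient_sampleLoss`). -/

/-! ### Concentration of functions with bounded differences -/

open MeasureTheory ProbabilityTheory in
/-- Fubini for a power of a measure, singling out the coordinate `i`. -/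
theorem integral_pi_eq_integral_insertNth {X : Type*} [MeasurableSpace X] (μ : Measure X)
    [IsProbabilityMeasure μ] {m : ℕ} (i : Fin (m + 1)) {F : (Fin (m + 1) → X) → ℝ}
    (hF : Integrable F (Measure.pi fun _ => μ)) :
    ∫ S, F S ∂(Measure.pi fun _ => μ) =
      ∫ S, ∫ a, F (i.insertNth a S) ∂μ ∂(Measure.pi fun _ => μ) := by
  have hmp := (measurePreserving_piFinSuccAbove (fun _ : Fin (m + 1) => μ) i).symm
  rw [← hmp.integral_comp' (g := F)]
  exact integral_prod_symm _ ((hmp.integrable_comp_emb (MeasurableEquiv.measurableEmbedding _)).2 hF)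

open MeasureTheory ProbabilityTheory in
theorem measurable_insertNth {X : Type*} [MeasurableSpace X] {m : ℕ} (i : Fin (m + 1)) :
    Measurable fun p : X × (Fin m → X) => (i.insertNth p.1 p.2 : Fin (m + 1) → X) :=
  (MeasurableEquiv.piFinSuccAbove (fun _ : Fin (m + 1) => X) i).symm.measurable

open MeasureTheory in
theorem integrable_of_abs_le {Ω : Type*} [MeasurableSpace Ω] {μ : Measure Ω} [IsFiniteMeasure μ]
    {f : Ω → ℝ} (hf : Measurable f) {B : ℝ} (hB : ∀ x, |f x| ≤ B) : Integrable f μ :=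
  .of_bound hf.aestronglyMeasurable B (.of_forall hB)

open MeasureTheory in
theorem abs_integral_le_of_abs_le {Ω : Type*} [MeasurableSpace Ω] {μ : Measure Ω}
    [IsProbabilityMeasure μ] {f : Ω → ℝ} {B : ℝ} (hB : ∀ x, |f x| ≤ B) : |∫ x, f x ∂μ| ≤ B := by
  simpa using norm_integral_le_of_norm_le_const (μ := μ) (f := f) (.of_forall hB)

open MeasureTheory ProbabilityTheory in
/-- McDiarmid's inequality in its sub-Gaussian form: integrating out one coordinate at a time,
each coordinate contributes the variance proxy `(c / 2) ^ 2` of Hoeffding's lemma. -/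
theorem hasSubgaussianMGF_of_bounded_differences {X : Type*} [MeasurableSpace X] (μ : Measure X)
    [IsProbabilityMeasure μ] (c : ℝ≥0) {B : ℝ} (m : ℕ) (F : (Fin m → X) → ℝ) (hF : Measurable F)
    (hB : ∀ S, |F S| ≤ B) (hc : ∀ S i a, |F (Function.update S i a) - F S| ≤ c) :
    HasSubgaussianMGF (fun S => F S - ∫ S', F S' ∂(Measure.pi fun _ => μ)) (m * (c / 2) ^ 2)
      (Measure.pi fun _ => μ) := by
  induction m with
  | zero =>
    have : (fun S => F S - ∫ S', F S' ∂(Measure.pi fun _ => μ)) = fun _ => 0 := by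
      funext S
      have : F = fun _ => F S := funext fun S' => congrArg F (Subsingleton.elim _ _)
      rw [this]; simp
    rw [this]
    simp
  | succ m ih =>
    have hFi : Integrable F (Measure.pi fun _ => μ) := integrable_of_abs_le hF hB
    set E := ∫ S', F S' ∂(Measure.pi fun _ => μ) with hE
    let G : (Fin m → X) → ℝ := fun S => ∫ a, F ((0 : Fin (m + 1)).insertNth a S) ∂μ
    have hFm : Measurable fun p : X × (Fin m → X) => F ((0 : Fin (m + 1)).insertNth p.1 p.2) :=
      hF.comp (measurable_insertNth 0)
    have hFa : ∀ S, Measurable fun a => F ((0 : Fin (m + 1)).insertNth a S) := fun S =>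
      hFm.comp (measurable_id.prodMk measurable_const)
    have hG : Measurable G := (hFm.stronglyMeasurable.integral_prod_left').measurable
    have hGB : ∀ S, |G S| ≤ B := fun S => abs_integral_le_of_abs_le fun a => hB _
    have hGE : E = ∫ S, G S ∂(Measure.pi fun _ => μ) := integral_pi_eq_integral_insertNth μ 0 hFi
    have hGc : ∀ S i a, |G (Function.update S i a) - G S| ≤ c := by
      intro S i a
      have : G (Function.update S i a) - G S = ∫ b, (F ((0 : Fin (m + 1)).insertNth b
          (Function.update S i a)) - F ((0 : Fin (m + 1)).insertNth b S)) ∂μ :=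
        (integral_sub (integrable_of_abs_le (hFa _) fun _ => hB _)
          (integrable_of_abs_le (hFa _) fun _ => hB _)).symm
      rw [this]
      refine abs_integral_le_of_abs_le fun b => ?_
      simpa [Fin.cons_update] using hc ((0 : Fin (m + 1)).insertNth b S) i.succ a
    have ihG := ih G hG hGB hGc
    rw [← hGE] at ihG
    have hexp : ∀ t : ℝ, Integrable (fun S => Real.exp (t * (F S - E))) (Measure.pi fun _ => μ) := by
      intro t
      refine integrable_of_abs_le (B := Real.exp (|t| * (B + |E|))) (by fun_prop) fun S => ?_
      rw [abs_of_pos (Real.exp_pos _), Real.exp_le_exp]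
      refine (le_abs_self _).trans ?_
      rw [abs_mul]
      gcongr
      exact (abs_sub _ _).trans (by gcongr; exact hB S)
    refine ⟨hexp, fun t => ?_⟩
    have hinner : ∀ S, ∫ a, Real.exp (t * (F ((0 : Fin (m + 1)).insertNth a S) - E)) ∂μ ≤
        Real.exp (((c / 2 : ℝ≥0) ^ 2 : ℝ≥0) * t ^ 2 / 2) * Real.exp (t * (G S - E)) := by
      intro S
      let b : ℝ := ⨅ a, F ((0 : Fin (m + 1)).insertNth a S)
      have hbdd : BddBelow (Set.range fun a => F ((0 : Fin (m + 1)).insertNth a S)) :=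
        ⟨-B, by rintro _ ⟨a, rfl⟩; exact (abs_le.1 (hB _)).1⟩
      have hIcc : ∀ a, F ((0 : Fin (m + 1)).insertNth a S) ∈ Set.Icc b (b + c) := by
        intro a
        have : Nonempty X := ⟨a⟩
        refine ⟨ciInf_le hbdd a, ?_⟩
        rw [← sub_le_iff_le_add]
        refine le_ciInf fun a' => ?_
        have := (abs_le.1 (hc ((0 : Fin (m + 1)).insertNth a' S) 0 a)).2
        simp at this
        simp
        linarith
      have hoeff := (hasSubgaussianMGF_of_mem_Icc (μ := μ) (hFa S).aemeasurable
        (.of_forall hIcc)).mgf_le t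
      have hcc : ‖b + c - b‖₊ = c := by
        rw [add_sub_cancel_left]; simp
      rw [hcc] at hoeff
      calc ∫ a, Real.exp (t * (F ((0 : Fin (m + 1)).insertNth a S) - E)) ∂μ
          = (∫ a, Real.exp (t * (F ((0 : Fin (m + 1)).insertNth a S) - G S)) ∂μ) *
              Real.exp (t * (G S - E)) := by
            rw [← integral_mul_const]
            refine integral_congr_ae (.of_forall fun a => ?_)
            simp only
            rw [← Real.exp_add]; ring_nf
        _ ≤ _ := by
            gcongr
            exact hoeff
    calc mgf (fun S => F S - E) (Measure.pi fun _ => μ) t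
        = ∫ S, ∫ a, Real.exp (t * (F ((0 : Fin (m + 1)).insertNth a S) - E)) ∂μ
            ∂(Measure.pi fun _ => μ) := integral_pi_eq_integral_insertNth μ 0 (hexp t)
      _ ≤ ∫ S, Real.exp (((c / 2 : ℝ≥0) ^ 2 : ℝ≥0) * t ^ 2 / 2) * Real.exp (t * (G S - E))
            ∂(Measure.pi fun _ => μ) :=
          integral_mono_of_nonneg (.of_forall fun S => integral_nonneg fun a => (Real.exp_pos _).le)
            ((ihG.integrable_exp_mul t).const_mul _) (.of_forall hinner)
      _ ≤ Real.exp (((c / 2 : ℝ≥0) ^ 2 : ℝ≥0) * t ^ 2 / 2) *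
            Real.exp ((m * (c / 2) ^ 2 : ℝ≥0) * t ^ 2 / 2) := by
          rw [integral_const_mul]
          gcongr
          exact ihG.mgf_le t
      _ = _ := by
          rw [← Real.exp_add]
          congr 1
          push_cast
          ring

open MeasureTheory ProbabilityTheory in
/-- McDiarmid's inequality, one-sided, solved for the deviation. -/
theorem mcdiarmid {X : Type*} [MeasurableSpace X] (μ : Measure X)
    [IsProbabilityMeasure μ] {c B : ℝ} (m : ℕ) (hm : 0 < m) (F : (Fin m → X) → ℝ)
    (hF : Measurable F) (hB : ∀ S, |F S| ≤ B)
    (hc0 : 0 ≤ c) (hc : ∀ S i a, |F (Function.update S i a) - F S| ≤ c / m)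
    {δ : ℝ} (hδ : 0 < δ) (hδ1 : δ < 1) :
    ENNReal.ofReal (1 - δ) ≤ Measure.pi (fun _ : Fin m => μ)
      {S | F S ≤ ∫ S', F S' ∂(Measure.pi fun _ => μ) + c * √(Real.log (1 / δ) / (2 * m))} := by
  set E := ∫ S', F S' ∂(Measure.pi fun _ => μ)
  have hm' : (0 : ℝ) < m := Nat.cast_pos.2 hm
  obtain ⟨c', hc'⟩ : ∃ c' : ℝ≥0, (c' : ℝ) = c / m := ⟨⟨c / m, by positivity⟩, rfl⟩
  have hsub := hasSubgaussianMGF_of_bounded_differences μ c' m F hF hB (by simpa only [hc'] using hc)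
  have hmeas : ∀ x : ℝ, MeasurableSet {S | F S ≤ x} := fun x => measurableSet_le hF measurable_const
  rcases hc0.eq_or_lt with rfl | hcpos
  · -- The Chernoff bound is void for variance proxy zero, but then `F` is almost surely constant.
    have h0 : (m : ℝ≥0) * (c' / 2) ^ 2 = 0 := by
      have : c' = 0 := by ext; simpa using hc'
      simp [this]
    rw [h0] at hsub
    have h1 : ∀ᵐ S ∂(Measure.pi fun _ : Fin m => μ),
        S ∈ {S | F S ≤ E + 0 * √(Real.log (1 / δ) / (2 * m))} := by
      filter_upwards [hsub.ae_eq_zero_of_hasSubgaussianMGF_zero] with S hS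
      have : F S - E = 0 := hS
      change F S ≤ _; linarith
    rw [(mem_ae_iff_prob_eq_one (hmeas _)).1 h1]
    exact ENNReal.ofReal_le_one.2 (by linarith)
  · have hlog : 0 < Real.log (1 / δ) := Real.log_pos (by rw [lt_div_iff₀ hδ]; linarith)
    set ε := c * √(Real.log (1 / δ) / (2 * m)) with hε
    have htail := hsub.measure_ge_le (ε := ε) (by positivity)
    have hval : -ε ^ 2 / (2 * ((m * (c' / 2) ^ 2 : ℝ≥0) : ℝ)) = Real.log δ := by
      have : ε ^ 2 = c ^ 2 * (Real.log (1 / δ) / (2 * m)) := by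
        rw [hε, mul_pow, Real.sq_sqrt (by positivity)]
      rw [this, one_div, Real.log_inv]
      push_cast
      rw [hc']
      field_simp
    rw [hval, Real.exp_log hδ] at htail
    rw [← ofReal_measureReal]
    apply ENNReal.ofReal_le_ofReal
    have hcompl := probReal_compl_eq_one_sub (μ := Measure.pi fun _ : Fin m => μ) (hmeas (E + ε))
    have hle : (Measure.pi fun _ : Fin m => μ).real {S | F S ≤ E + ε}ᶜ ≤ δ := by
      refine (measureReal_mono ?_).trans htail
      intro S hS
      simp only [Set.mem_compl_iff, Set.mem_ofPred_eq, not_le] at hS ⊢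
      linarith
    linarith

/-! ### Uniform stability implies generalization -/

open MeasureTheory in
/-- A randomized learning algorithm enters only through `h S z`, the expected loss at `z` of its
output on the training set `S`. If replacing one training sample changes `h` by at most `β / m`,
then the generalization gap has expectation at most `β / m` by symmetry of the sample and the ghost
sample, and has differences bounded by `(2 * β + C) / m`, so it concentrates. -/
theorem generalization_of_uniform_stability {X : Type*} [MeasurableSpace X] (μ : Measure X)
    [IsProbabilityMeasure μ] {m : ℕ} (hm : 0 < m) (h : (Fin m → X) → X → ℝ)
    (hh : Measurable (Function.uncurry h)) {C β : ℝ} (hβ : 0 ≤ β) (hC : 0 ≤ C)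
    (h0 : ∀ S z, 0 ≤ h S z) (h1 : ∀ S z, h S z ≤ C)
    (hst : ∀ S i a z, |h (Function.update S i a) z - h S z| ≤ β / m)
    {δ : ℝ} (hδ : 0 < δ) (hδ1 : δ < 1) :
    ENNReal.ofReal (1 - δ) ≤ Measure.pi (fun _ : Fin m => μ)
      {S | ∫ z, h S z ∂μ ≤ (∑ i, h S (S i)) / m + β / m +
        (2 * β + C) * √(Real.log (1 / δ) / (2 * m))} := by
  have hm' : (0 : ℝ) < m := Nat.cast_pos.2 hm
  have habs : ∀ S z, |h S z| ≤ C := fun S z => abs_le.2 ⟨by linarith [h0 S z], h1 S z⟩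
  have hhz : ∀ S, Measurable (h S) := fun S => hh.comp (measurable_const.prodMk measurable_id)
  have hint : ∀ S, Integrable (h S) μ := fun S => integrable_of_abs_le (hhz S) (habs S)
  have hdiag : ∀ i, Measurable fun S : Fin m → X => h S (S i) := fun i =>
    hh.comp (measurable_id.prodMk (measurable_pi_apply i))
  have hR : Measurable fun S => ∫ z, h S z ∂μ :=
    (hh.stronglyMeasurable.integral_prod_right).measurable
  have hRabs : ∀ S, |∫ z, h S z ∂μ| ≤ C := fun S => abs_integral_le_of_abs_le (habs S)
  have hEabs : ∀ S : Fin m → X, |(∑ i, h S (S i)) / m| ≤ C := by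
    intro S
    rw [abs_div, abs_of_pos hm', div_le_iff₀ hm']
    refine (Finset.abs_sum_le_sum_abs _ _).trans ?_
    refine (Finset.sum_le_card_nsmul _ _ C fun i _ => habs _ _).trans ?_
    simp [mul_comm]
  let F : (Fin m → X) → ℝ := fun S => ∫ z, h S z ∂μ - (∑ i, h S (S i)) / m
  have hF : Measurable F := hR.sub ((Finset.measurable_sum _ fun i _ => hdiag i).div_const _)
  have hFB : ∀ S, |F S| ≤ C + C := fun S => (abs_sub _ _).trans (add_le_add (hRabs S) (hEabs S))
  have hFc : ∀ S i a, |F (Function.update S i a) - F S| ≤ (2 * β + C) / m := by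
    intro S i a
    have hr : |∫ z, h (Function.update S i a) z ∂μ - ∫ z, h S z ∂μ| ≤ β / m := by
      rw [← integral_sub (hint _) (hint _)]
      exact abs_integral_le_of_abs_le fun z => hst S i a z
    have he : |(∑ j, h (Function.update S i a) (Function.update S i a j)) - ∑ j, h S (S j)| ≤
        β + C := by
      rw [← Finset.sum_sub_distrib]
      refine (Finset.abs_sum_le_sum_abs _ _).trans ?_
      have : ∀ j, |h (Function.update S i a) (Function.update S i a j) - h S (S j)| ≤
          β / m + if j = i then C else 0 := by
        intro j
        split_ifs with hj
        · have hb : 0 ≤ β / m := by positivity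
          refine (abs_sub_le_iff.2 ⟨?_, ?_⟩ : _ ≤ C).trans (by linarith)
          · linarith [h0 S (S j), h1 (Function.update S i a) (Function.update S i a j)]
          · linarith [h1 S (S j), h0 (Function.update S i a) (Function.update S i a j)]
        · rw [Function.update_of_ne hj, add_zero]
          exact hst _ _ _ _
      refine (Finset.sum_le_sum fun j _ => this j).trans ?_
      rw [Finset.sum_add_distrib]
      simp
      field_simp
      exact le_rfl
    have : F (Function.update S i a) - F S = (∫ z, h (Function.update S i a) z ∂μ - ∫ z, h S z ∂μ) -
        ((∑ j, h (Function.update S i a) (Function.update S i a j)) - ∑ j, h S (S j)) / m := by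
      simp only [F]; ring
    rw [this]
    refine (abs_sub _ _).trans ?_
    rw [abs_div, abs_of_pos hm']
    calc _ ≤ β / m + (β + C) / m := by gcongr
      _ = _ := by ring
  have hmean : ∫ S, F S ∂(Measure.pi fun _ => μ) ≤ β / m := by
    obtain ⟨k, rfl⟩ : ∃ k, m = k + 1 := ⟨m - 1, by omega⟩
    have hgap : ∀ i, Integrable (fun S : Fin (k + 1) → X => ∫ z, h S z ∂μ - h S (S i))
        (Measure.pi fun _ => μ) := fun i => integrable_of_abs_le (hR.sub (hdiag i))
          fun S => (abs_sub _ _).trans (add_le_add (hRabs S) (habs _ _))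
    have hi : ∀ i, ∫ S : Fin (k + 1) → X, (∫ z, h S z ∂μ - h S (S i)) ∂(Measure.pi fun _ => μ) ≤
        β / (k + 1 : ℕ) := by
      intro i
      rw [integral_pi_eq_integral_insertNth μ i (hgap i)]
      refine (le_abs_self _).trans (abs_integral_le_of_abs_le fun S => ?_)
      have hins : Measurable fun a : X => (i.insertNth a S : Fin (k + 1) → X) :=
        (measurable_insertNth i).comp (measurable_id.prodMk measurable_const)
      have hsame : ∫ a, (∫ z, h (i.insertNth a S) z ∂μ - h (i.insertNth a S)
          ((i.insertNth a S : Fin (k + 1) → X) i)) ∂μ =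
          ∫ a, (∫ z, (h (i.insertNth a S) z - h (i.insertNth z S) z) ∂μ) ∂μ := by
        have hz : Integrable (fun z => h (i.insertNth z S) z) μ :=
          integrable_of_abs_le (hh.comp (hins.prodMk measurable_id)) fun _ => habs _ _
        simp_rw [fun a => integral_sub (hint (i.insertNth a S)) hz]
        have hRi : Integrable (fun a => ∫ z, h (i.insertNth a S) z ∂μ) μ :=
          integrable_of_abs_le (hR.comp hins) fun _ => hRabs _
        rw [integral_sub hRi (integrable_const _)]
        simp only [Fin.insertNth_apply_same, integral_const, probReal_univ, one_smul]
        exact integral_sub hRi hz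
      rw [hsame]
      refine abs_integral_le_of_abs_le fun a => abs_integral_le_of_abs_le fun z => ?_
      simpa using hst (i.insertNth z S) i a z
    have hsum : ∀ S : Fin (k + 1) → X, F S =
        (∑ i, (∫ z, h S z ∂μ - h S (S i))) / (k + 1 : ℕ) := by
      intro S
      simp only [F, Finset.sum_sub_distrib, Finset.sum_const, Finset.card_univ, Fintype.card_fin,
        nsmul_eq_mul]
      field_simp
    simp_rw [hsum]
    rw [integral_div, integral_finsetSum _ fun i _ => hgap i, div_le_iff₀ hm']
    refine (Finset.sum_le_sum fun i _ => hi i).trans ?_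
    simp [mul_comm]
  refine (mcdiarmid μ m hm F hF hFB (by positivity) hFc hδ hδ1).trans (measure_mono ?_)
  intro S hS
  simp only [Set.mem_ofPred_eq, F] at hS ⊢
  linarith

/-! ### Filter coefficients and Lipschitz bounds -/

/-- The rows of a real symmetric matrix are bounded by its spectral radius: in an eigenbasis, the
row `A n` has the coordinates `λᵢ vᵢ(n)`, and `∑ᵢ vᵢ(n) ^ 2 = 1`. -/
theorem Matrix.IsHermitian.sum_row_sq_le {n : Type*} [Fintype n] [DecidableEq n]
    {A : Matrix n n ℝ} (hA : A.IsHermitian) {r : ℝ} (hr : ∀ i, |hA.eigenvalues i| ≤ r) (k : n) :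
    ∑ j, A k j ^ 2 ≤ r ^ 2 := by
  set b := hA.eigenvectorBasis with hb
  have hrow : ∀ i, inner ℝ (b i) (WithLp.toLp 2 (A k)) = hA.eigenvalues i * b i k := by
    intro i
    have := congrFun (hA.mulVec_eigenvectorBasis i) k
    simp only [Matrix.mulVec, dotProduct, Pi.smul_apply, smul_eq_mul] at this
    rw [← this, PiLp.inner_apply]
    simp [b]
  have hcol : ∀ i, inner ℝ (b i) (EuclideanSpace.single k (1 : ℝ)) = b i k := by
    intro i
    simp [EuclideanSpace.inner_single_right]
  have h1 := b.sum_sq_norm_inner_right (WithLp.toLp 2 (A k))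
  have h2 := b.sum_sq_norm_inner_right (EuclideanSpace.single k (1 : ℝ))
  simp only [hrow, hcol, Real.norm_eq_abs, sq_abs] at h1 h2
  rw [EuclideanSpace.norm_sq_eq] at h1
  simp only [Real.norm_eq_abs, sq_abs] at h1
  rw [← h1]
  calc ∑ i, (hA.eigenvalues i * b i k) ^ 2 ≤ ∑ i, r ^ 2 * (b i k) ^ 2 := by
        refine Finset.sum_le_sum fun i _ => ?_
        rw [mul_pow]
        exact mul_le_mul_of_nonneg_right
          (sq_le_sq' (by linarith [(abs_le.1 (hr i)).1]) (abs_le.1 (hr i)).2) (sq_nonneg _)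
    _ = r ^ 2 := by rw [← Finset.mul_sum, h2]; simp

namespace GraphFilter

theorem sum_mat_sq_le {d : ℕ} {Y : Type*} (g : GraphFilter) (z : GraphSample d Y)
    (n : Fin z.size) : ∑ j, g.mat z n j ^ 2 ≤ g.lambdaMax z ^ 2 :=
  (g.mat_isHermitian z).sum_row_sq_le (fun i => le_ciSup (f := fun i =>
    |(g.mat_isHermitian z).eigenvalues i|) (Set.finite_range _).bddAbove i) n

theorem lambdaMax_nonneg {d : ℕ} {Y : Type*} (g : GraphFilter) (z : GraphSample d Y) :
    0 ≤ g.lambdaMax z :=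
  Real.iSup_nonneg fun _ => abs_nonneg _

/-- Normalized signals have entries in `[-1, 1]`, so that taking powers keeps them normalized and
Cauchy-Schwarz bounds the aggregated feature by the norm of a row of `g(L)`. -/
theorem abs_aggregate_le {d : ℕ} {Y : Type*} (g : GraphFilter) (z : GraphSample d Y)
    (hz : g.SignalNormalized z) (n : Fin z.size) (k : Fin d) (p : ℕ) :
    |∑ j ∈ g.nbhd z n, g.mat z n j * z.feat j k ^ (p + 1)| ≤ g.lambdaMax z := by
  refine abs_le_of_sq_le_sq ?_ (g.lambdaMax_nonneg z)
  refine (Finset.sum_mul_sq_le_sq_mul_sq _ _ _).trans ?_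
  have h1 : ∑ j ∈ g.nbhd z n, g.mat z n j ^ 2 ≤ g.lambdaMax z ^ 2 :=
    (Finset.sum_le_univ_sum_of_nonneg fun j => sq_nonneg _).trans (g.sum_mat_sq_le z n)
  have h2 : ∑ j ∈ g.nbhd z n, (z.feat j k ^ (p + 1)) ^ 2 ≤ 1 := by
    refine (Finset.sum_le_sum fun j hj => ?_).trans (hz n k)
    have hle : z.feat j k ^ 2 ≤ 1 :=
      (Finset.single_le_sum (f := fun j => z.feat j k ^ 2) (fun _ _ => sq_nonneg _) hj).trans
        (hz n k)
    rw [← pow_mul, mul_comm, pow_mul]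
    exact pow_le_of_le_one (sq_nonneg _) hle (Nat.succ_ne_zero p)
  calc _ ≤ g.lambdaMax z ^ 2 * 1 :=
        mul_le_mul h1 h2 (Finset.sum_nonneg fun _ _ => sq_nonneg _) (sq_nonneg _)
    _ = _ := mul_one _

end GraphFilter

theorem IsLipschitzSmooth.contDiff {α ν : ℝ≥0} {h : ℝ → ℝ} (hh : IsLipschitzSmooth α ν h) :
    ContDiff ℝ 1 h :=
  contDiff_one_iff_deriv.2 ⟨hh.differentiable, hh.lipschitz_deriv.continuous⟩

theorem IsLipschitzSmooth.abs_sub_le {α ν : ℝ≥0} {h : ℝ → ℝ} (hh : IsLipschitzSmooth α ν h)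
    (s t : ℝ) : |h s - h t| ≤ α * |s - t| := by
  simpa [Real.dist_eq] using hh.lipschitz.dist_le_mul s t

theorem encoder_sub_le {P d : ℕ} {Y : Type*} (g : GraphFilter) {σ : ℝ → ℝ} {α_s ν_s : ℝ≥0}
    (hσ : IsLipschitzSmooth α_s ν_s σ) (z : GraphSample d Y) (hz : g.SignalNormalized z)
    (θ θ' : EncoderParams P d) :
    |encoder g σ θ z - encoder g σ θ' z| ≤
      α_s * z.size * g.lambdaMax z * √(P * d) * ‖θ - θ'‖ := by
  have hl := g.lambdaMax_nonneg z
  have hl1 : ∑ p : Fin P, ∑ k : Fin d, |θ (p, k) - θ' (p, k)| ≤ √(P * d) * ‖θ - θ'‖ := by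
    rw [← Fintype.sum_prod_type' (f := fun p k => |θ (p, k) - θ' (p, k)|),
      EuclideanSpace.norm_eq, ← Real.sqrt_mul (by positivity)]
    refine Real.le_sqrt_of_sq_le ((sq_sum_le_card_mul_sum_sq).trans ?_)
    simp
  have hterm : ∀ n, ∀ p : Fin P,
      |σ (∑ j ∈ g.nbhd z n, g.mat z n j * ∑ k, z.feat j k ^ ((p : ℕ) + 1) * θ (p, k)) -
        σ (∑ j ∈ g.nbhd z n, g.mat z n j * ∑ k, z.feat j k ^ ((p : ℕ) + 1) * θ' (p, k))| ≤
      α_s * (g.lambdaMax z * ∑ k, |θ (p, k) - θ' (p, k)|) := by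
    intro n p
    refine (hσ.abs_sub_le _ _).trans ?_
    gcongr
    have : ∑ j ∈ g.nbhd z n, g.mat z n j * ∑ k, z.feat j k ^ ((p : ℕ) + 1) * θ (p, k) -
        ∑ j ∈ g.nbhd z n, g.mat z n j * ∑ k, z.feat j k ^ ((p : ℕ) + 1) * θ' (p, k) =
        ∑ k, (∑ j ∈ g.nbhd z n, g.mat z n j * z.feat j k ^ ((p : ℕ) + 1)) *
          (θ (p, k) - θ' (p, k)) := by
      simp_rw [Finset.sum_mul, Finset.mul_sum]
      rw [Finset.sum_comm, Finset.sum_comm (s := g.nbhd z n), ← Finset.sum_sub_distrib]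
      refine Finset.sum_congr rfl fun k _ => ?_
      rw [← Finset.sum_sub_distrib]
      exact Finset.sum_congr rfl fun j _ => by ring
    rw [this, Finset.mul_sum]
    refine (Finset.abs_sum_le_sum_abs _ _).trans (Finset.sum_le_sum fun k _ => ?_)
    rw [abs_mul]
    gcongr
    exact g.abs_aggregate_le z hz n k p
  unfold encoder
  rw [← Finset.sum_sub_distrib]
  simp_rw [← Finset.sum_sub_distrib]
  calc _ ≤ ∑ n : Fin z.size, ∑ p : Fin P, α_s * (g.lambdaMax z * ∑ k, |θ (p, k) - θ' (p, k)|) :=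
        (Finset.abs_sum_le_sum_abs _ _).trans (Finset.sum_le_sum fun n _ =>
          (Finset.abs_sum_le_sum_abs _ _).trans (Finset.sum_le_sum fun p _ => hterm n p))
    _ = α_s * z.size * g.lambdaMax z * ∑ p : Fin P, ∑ k : Fin d, |θ (p, k) - θ' (p, k)| := by
        simp only [← Finset.mul_sum, Finset.sum_const, Finset.card_univ, Fintype.card_fin,
          nsmul_eq_mul]
        ring
    _ ≤ α_s * z.size * g.lambdaMax z * (√(P * d) * ‖θ - θ'‖) := by gcongr
    _ = _ := by ring

theorem sampleLoss_sub_le {P d : ℕ} {Y : Type*} (g : GraphFilter) {σ : ℝ → ℝ} {ℓ : ℝ → Y → ℝ}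
    {α_s ν_s α_l ν_l : ℝ≥0} (hσ : IsLipschitzSmooth α_s ν_s σ)
    (hℓ : ∀ y, IsLipschitzSmooth α_l ν_l (fun s => ℓ s y)) {N : ℕ} {lam : ℝ}
    (z : GraphSample d Y) (hz : g.SignalNormalized z) (hN : z.size ≤ N)
    (hlam : g.lambdaMax z ≤ lam) (θ θ' : EncoderParams P d) :
    |sampleLoss g σ ℓ θ z - sampleLoss g σ ℓ θ' z| ≤
      α_l * (α_s * N * lam * √(P * d)) * ‖θ - θ'‖ := by
  have hl := g.lambdaMax_nonneg z
  rw [mul_assoc]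
  refine ((hℓ z.label).abs_sub_le _ _).trans ?_
  gcongr
  exact (encoder_sub_le g hσ z hz θ θ').trans (by gcongr)

/-! ### Smoothness and measurability of the sample loss -/

theorem contDiff_sampleLoss {P d : ℕ} {Y : Type*} (g : GraphFilter) {σ : ℝ → ℝ} {ℓ : ℝ → Y → ℝ}
    {α_s ν_s α_l ν_l : ℝ≥0} (hσ : IsLipschitzSmooth α_s ν_s σ)
    (hℓ : ∀ y, IsLipschitzSmooth α_l ν_l (fun s => ℓ s y)) (z : GraphSample d Y) :
    ContDiff ℝ 1 fun θ : EncoderParams P d => sampleLoss g σ ℓ θ z := by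
  have hs := hσ.contDiff
  refine (hℓ z.label).contDiff.comp ?_
  unfold encoder
  fun_prop

/-- The graph enters the loss only through finitely many values, so no measurability of the filter
is needed. -/
theorem measurable_sampleLoss {P d : ℕ} {Y : Type*} [MeasurableSpace Y] (g : GraphFilter)
    {σ : ℝ → ℝ} (hσ : Measurable σ) {ℓ : ℝ → Y → ℝ} (hℓ : Measurable (Function.uncurry ℓ))
    (θ : EncoderParams P d) : Measurable fun z : GraphSample d Y => sampleLoss g σ ℓ θ z := by
  have hsigma : ∀ f : GraphSample d Y → ℝ, (∀ n, Measurable fun q => f ⟨n, q⟩) → Measurable f :=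
    fun f hf s hs => MeasurableSpace.measurableSet_iInf.2 fun n => hf n hs
  refine hsigma _ fun n => ?_
  have : MeasurableSingletonClass (SimpleGraph (Fin n)) := by
    refine ⟨fun G => ?_⟩
    have : ({G} : Set (SimpleGraph (Fin n))) = ⋂ u, ⋂ v, {H | H.Adj u v ↔ G.Adj u v} := by
      ext H
      simp [SimpleGraph.ext_iff, funext_iff]
    rw [this]
    refine MeasurableSet.iInter fun u => MeasurableSet.iInter fun v => ?_
    have hadj : Measurable fun H : SimpleGraph (Fin n) => H.Adj u v := by fun_prop
    exact hadj (t := {q : Prop | q ↔ G.Adj u v}) trivial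
  refine measurable_from_prod_countable_right fun G => ?_
  suffices henc : Measurable fun q : (Fin n → Fin d → ℝ) × Y =>
      encoder g σ θ (⟨n, G, q⟩ : GraphSample d Y) from hℓ.comp (henc.prodMk measurable_snd)
  classical
  let A := g.toFun n (G.lapMatrix ℝ)
  have henc : ∀ q : (Fin n → Fin d → ℝ) × Y, encoder g σ θ (⟨n, G, q⟩ : GraphSample d Y) =
      ∑ i : Fin n, ∑ p : Fin P,
        σ (∑ j with A i j ≠ 0, A i j * ∑ k, q.1 j k ^ ((p : ℕ) + 1) * θ (p, k)) := by
    exact fun q => rfl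
  simp_rw [henc]
  fun_prop

theorem measurable_uncurry_sampleLoss {P d : ℕ} {Y : Type*} [MeasurableSpace Y] (g : GraphFilter)
    {σ : ℝ → ℝ} {ℓ : ℝ → Y → ℝ} {α_s ν_s α_l ν_l : ℝ≥0} (hσ : IsLipschitzSmooth α_s ν_s σ)
    (hℓm : Measurable (Function.uncurry ℓ))
    (hℓ : ∀ y, IsLipschitzSmooth α_l ν_l (fun s => ℓ s y)) :
    Measurable fun q : EncoderParams P d × GraphSample d Y => sampleLoss g σ ℓ q.1 q.2 :=
  MeasureTheory.measurable_uncurry_of_continuous_of_measurable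
    (fun z => (contDiff_sampleLoss g hσ hℓ z).continuous)
    (fun θ => measurable_sampleLoss g hσ.differentiable.continuous.measurable hℓm θ)

/-- The gradient is continuous in the parameter, and in the sample it is a pointwise limit of
difference quotients, so it is jointly measurable. -/
theorem measurable_gradient_sampleLoss {P d : ℕ} {Y : Type*} [MeasurableSpace Y] (g : GraphFilter)
    {σ : ℝ → ℝ} {ℓ : ℝ → Y → ℝ} {α_s ν_s α_l ν_l : ℝ≥0} (hσ : IsLipschitzSmooth α_s ν_s σ)
    (hℓm : Measurable (Function.uncurry ℓ))
    (hℓ : ∀ y, IsLipschitzSmooth α_l ν_l (fun s => ℓ s y)) :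
    Measurable fun q : EncoderParams P d × GraphSample d Y =>
      gradient (fun θ => sampleLoss g σ ℓ θ q.2) q.1 := by
  refine MeasureTheory.measurable_uncurry_of_continuous_of_measurable
    (u := fun θ (z : GraphSample d Y) => gradient (fun θ' => sampleLoss g σ ℓ θ' z) θ)
    (fun z => ?_) fun θ => ?_
  · exact (InnerProductSpace.toDual ℝ (EncoderParams P d)).symm.continuous.comp
      ((contDiff_sampleLoss g hσ hℓ z).continuous_fderiv one_ne_zero)
  · have hcoord : ∀ i, Measurable fun z : GraphSample d Y =>
        gradient (fun θ' => sampleLoss g σ ℓ θ' z) θ i := by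
      intro i
      have heq : ∀ z : GraphSample d Y, gradient (fun θ' => sampleLoss g σ ℓ θ' z) θ i =
          fderiv ℝ (fun θ' => sampleLoss g σ ℓ θ' z) θ (EuclideanSpace.single i 1) := by
        intro z
        rw [← inner_gradient_left, EuclideanSpace.inner_single_right]
        simp
      simp_rw [heq]
      have hm := measurable_sampleLoss (P := P) (d := d) g hσ.differentiable.continuous.measurable hℓm
      refine measurable_of_tendsto_metrizable (f := fun (k : ℕ) z => (k : ℝ) •
        (sampleLoss g σ ℓ (θ + (k : ℝ)⁻¹ • EuclideanSpace.single i 1) z - sampleLoss g σ ℓ θ z))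
        (fun k => ((hm _).sub (hm _)).const_smul (k : ℝ)) ?_
      rw [tendsto_pi_nhds]
      intro z
      exact (((contDiff_sampleLoss g hσ hℓ z).differentiable one_ne_zero θ).hasFDerivAt.lim_real
        _).comp tendsto_natCast_atTop_atTop
    exact (WithLp.measurable_toLp 2 _).comp (measurable_pi_lambda _ hcoord)

/-! ### Stability of stochastic gradient descent -/

theorem norm_gradient_sampleLoss_le {P d : ℕ} {Y : Type*} {g : GraphFilter} {σ : ℝ → ℝ}
    {ℓ : ℝ → Y → ℝ} {z : GraphSample d Y} {B : ℝ} (hB : 0 ≤ B)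
    (hlip : ∀ θ θ' : EncoderParams P d,
      |sampleLoss g σ ℓ θ z - sampleLoss g σ ℓ θ' z| ≤ B * ‖θ - θ'‖) (θ : EncoderParams P d) :
    ‖gradient (fun θ' => sampleLoss g σ ℓ θ' z) θ‖ ≤ B := by
  rw [gradient, LinearIsometryEquiv.norm_map]
  exact norm_fderiv_le_of_lip' ℝ hB (.of_forall fun θ' => hlip θ' θ)

theorem norm_sgd_sub_init_le {P d m : ℕ} {Y : Type*} {g : GraphFilter} {σ : ℝ → ℝ}
    {ℓ : ℝ → Y → ℝ} {η B : ℝ} (hη : 0 ≤ η) (θ₀ : EncoderParams P d) {S : Fin m → GraphSample d Y}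
    (hS : ∀ i (θ : EncoderParams P d), ‖gradient (fun θ' => sampleLoss g σ ℓ θ' (S i)) θ‖ ≤ B)
    (T : ℕ) (ω : Fin T → Fin m) : ‖sgd g σ ℓ η θ₀ S T ω - θ₀‖ ≤ η * T * B := by
  induction T with
  | zero => simp [sgd]
  | succ t ih =>
    set θ := sgd g σ ℓ η θ₀ S t fun i => ω i.castSucc with hθ
    set v := gradient (fun θ' => sampleLoss g σ ℓ θ' (S (ω (Fin.last t)))) θ with hv
    have : sgd g σ ℓ η θ₀ S (t + 1) ω - θ₀ = (θ - θ₀) - η • v := by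
      simp only [sgd, ← hθ, ← hv]; abel
    rw [this]
    calc _ ≤ ‖θ - θ₀‖ + ‖η • v‖ := norm_sub_le _ _
      _ ≤ η * t * B + η * B := by
          rw [norm_smul, Real.norm_of_nonneg hη]
          gcongr
          · exact ih _
          · exact hS _ _
      _ = _ := by push_cast; ring

theorem sgd_congr {P d m : ℕ} {Y : Type*} {g : GraphFilter} {σ : ℝ → ℝ}
    {ℓ : ℝ → Y → ℝ} {η : ℝ} {θ₀ : EncoderParams P d} {S S' : Fin m → GraphSample d Y} {T : ℕ}
    {ω : Fin T → Fin m} (h : ∀ t, S (ω t) = S' (ω t)) :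
    sgd g σ ℓ η θ₀ S T ω = sgd g σ ℓ η θ₀ S' T ω := by
  induction T with
  | zero => rfl
  | succ t ih => simp only [sgd, h (Fin.last t), ih fun i => h i.castSucc]

theorem measurable_sgd {P d m : ℕ} {Y : Type*} [MeasurableSpace Y] (g : GraphFilter)
    {σ : ℝ → ℝ} {ℓ : ℝ → Y → ℝ} {α_s ν_s α_l ν_l : ℝ≥0} (hσ : IsLipschitzSmooth α_s ν_s σ)
    (hℓm : Measurable (Function.uncurry ℓ))
    (hℓ : ∀ y, IsLipschitzSmooth α_l ν_l (fun s => ℓ s y)) (η : ℝ) (θ₀ : EncoderParams P d)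
    (T : ℕ) (ω : Fin T → Fin m) :
    Measurable fun S : Fin m → GraphSample d Y => sgd g σ ℓ η θ₀ S T ω := by
  induction T with
  | zero => exact measurable_const
  | succ t ih =>
    exact (ih _).sub (((measurable_gradient_sampleLoss g hσ hℓm hℓ).comp
      ((ih _).prodMk (measurable_pi_apply (ω (Fin.last t))))).const_smul η)

/-- The expected number of iterations in which SGD draws the index `i` is `T / m`. -/
theorem sgdExpectation_card_eq {T m : ℕ} (hm : 0 < m) (i : Fin m) :
    sgdExpectation (fun ω : Fin T → Fin m => ∑ t, if ω t = i then (1 : ℝ) else 0) = T / m := by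
  have hm' : (m : ℝ) ≠ 0 := by positivity
  have hcard : ∀ t : Fin T, ∑ ω : Fin T → Fin m, (if ω t = i then (1 : ℝ) else 0) =
      (m : ℝ) ^ (T - 1) := by
    intro t
    have := Fintype.card_filter_piFinset_const_eq_of_mem (ι := Fin T) Finset.univ t
      (Finset.mem_univ i)
    simp only [Fintype.piFinset_univ, Finset.card_univ, Fintype.card_fin] at this
    rw [Finset.sum_boole, this]
    push_cast
    rfl
  unfold sgdExpectation
  rw [Finset.sum_comm, Finset.sum_congr rfl fun t _ => hcard t]
  cases T with
  | zero => simp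
  | succ t =>
    simp only [Finset.sum_const, Finset.card_univ, Fintype.card_fin, nsmul_eq_mul,
      Nat.add_sub_cancel, pow_succ]
    field_simp

theorem sgdExpectation_mono {T m : ℕ} {f f' : (Fin T → Fin m) → ℝ} (h : ∀ ω, f ω ≤ f' ω) :
    sgdExpectation f ≤ sgdExpectation f' := by
  unfold sgdExpectation
  gcongr with ω
  exact h ω

theorem sgdExpectation_const {T m : ℕ} (hm : 0 < m) (c : ℝ) :
    sgdExpectation (fun _ : Fin T → Fin m => c) = c := by
  have hm' : (m : ℝ) ≠ 0 := by positivity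
  simp [sgdExpectation, mul_div_cancel_left₀ c (pow_ne_zero T hm')]

theorem abs_sgdExpectation_sub_le {T m : ℕ} (f f' : (Fin T → Fin m) → ℝ) :
    |sgdExpectation f - sgdExpectation f'| ≤ sgdExpectation fun ω => |f ω - f' ω| := by
  unfold sgdExpectation
  rw [← sub_div, ← Finset.sum_sub_distrib, abs_div, abs_of_nonneg (by positivity : (0 : ℝ) ≤ m ^ T)]
  gcongr
  exact Finset.abs_sum_le_sum_abs _ _

/-- Uniform stability of SGD: two runs with the same indices, on training sets that differ at the
index `i`, produce the same parameter unless `i` is drawn, which has probability at most `T / m`,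
and always stay within distance `2 * (η * T * B)` of each other. -/
theorem sgd_uniformly_stable {P d m : ℕ} {Y : Type*} {g : GraphFilter} {σ : ℝ → ℝ}
    {ℓ : ℝ → Y → ℝ} {η B : ℝ} (hη : 0 ≤ η) (hB : 0 ≤ B) (hm : 0 < m) {𝒵 : Set (GraphSample d Y)}
    (hlip : ∀ z ∈ 𝒵, ∀ θ θ' : EncoderParams P d,
      |sampleLoss g σ ℓ θ z - sampleLoss g σ ℓ θ' z| ≤ B * ‖θ - θ'‖)
    (θ₀ : EncoderParams P d) (T : ℕ) {S S' : Fin m → GraphSample d Y} (hS : ∀ j, S j ∈ 𝒵)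
    (hS' : ∀ j, S' j ∈ 𝒵) (i : Fin m) (hSS' : ∀ j ≠ i, S j = S' j) {z : GraphSample d Y}
    (hz : z ∈ 𝒵) :
    |sgdExpectation (fun ω : Fin T → Fin m => sampleLoss g σ ℓ (sgd g σ ℓ η θ₀ S T ω) z) -
      sgdExpectation (fun ω : Fin T → Fin m => sampleLoss g σ ℓ (sgd g σ ℓ η θ₀ S' T ω) z)| ≤
      2 * η * T ^ 2 * B ^ 2 / m := by
  refine (abs_sgdExpectation_sub_le _ _).trans ?_
  have hpt : ∀ ω : Fin T → Fin m, |sampleLoss g σ ℓ (sgd g σ ℓ η θ₀ S T ω) z -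
      sampleLoss g σ ℓ (sgd g σ ℓ η θ₀ S' T ω) z| ≤
      2 * η * T * B ^ 2 * ∑ t, if ω t = i then (1 : ℝ) else 0 := by
    intro ω
    by_cases hω : ∃ t, ω t = i
    · obtain ⟨t, ht⟩ := hω
      have h1 : (1 : ℝ) ≤ ∑ t, if ω t = i then (1 : ℝ) else 0 := by
        refine le_trans ?_ (Finset.single_le_sum (fun t _ => by split_ifs <;> simp)
          (Finset.mem_univ t))
        simp [ht]
      have hgrad : ∀ {S : Fin m → GraphSample d Y}, (∀ j, S j ∈ 𝒵) →
          ‖sgd g σ ℓ η θ₀ S T ω - θ₀‖ ≤ η * T * B := fun hS =>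
        norm_sgd_sub_init_le hη θ₀
          (fun j => norm_gradient_sampleLoss_le hB (hlip _ (hS j))) T ω
      have hdist : ‖sgd g σ ℓ η θ₀ S T ω - sgd g σ ℓ η θ₀ S' T ω‖ ≤
          η * T * B + η * T * B := by
        rw [← sub_sub_sub_cancel_right _ _ θ₀]
        exact (norm_sub_le _ _).trans (add_le_add (hgrad hS) (hgrad hS'))
      calc _ ≤ B * ‖sgd g σ ℓ η θ₀ S T ω - sgd g σ ℓ η θ₀ S' T ω‖ := hlip z hz _ _
        _ ≤ B * (η * T * B + η * T * B) := by gcongr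
        _ = 2 * η * T * B ^ 2 * 1 := by ring
        _ ≤ _ := by gcongr
    · push Not at hω
      rw [sgd_congr fun t => hSS' _ (hω t)]
      simp [hω]
  refine (sgdExpectation_mono hpt).trans (le_of_eq ?_)
  have hlin : sgdExpectation (fun ω : Fin T → Fin m =>
      2 * η * T * B ^ 2 * ∑ t, if ω t = i then (1 : ℝ) else 0) = 2 * η * T * B ^ 2 *
      sgdExpectation (fun ω : Fin T → Fin m => ∑ t, if ω t = i then (1 : ℝ) else 0) := by
    unfold sgdExpectation
    rw [← Finset.mul_sum, mul_div_assoc]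
  rw [hlin, sgdExpectation_card_eq hm]
  ring

open MeasureTheory in
/-- The generalization bound for SGD on a loss that is `B`-Lipschitz in the parameter on almost all
samples. -/
theorem sgd_generalization {P d m : ℕ} {Y : Type*} [MeasurableSpace Y] {g : GraphFilter}
    {σ : ℝ → ℝ} {ℓ : ℝ → Y → ℝ} {α_s ν_s α_l ν_l : ℝ≥0} (hσ : IsLipschitzSmooth α_s ν_s σ)
    (hℓm : Measurable (Function.uncurry ℓ))
    (hℓ : ∀ y, IsLipschitzSmooth α_l ν_l (fun s => ℓ s y))
    (μ : Measure (GraphSample d Y)) [IsProbabilityMeasure μ] {𝒵 : Set (GraphSample d Y)}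
    (h𝒵 : ∀ᵐ z ∂μ, z ∈ 𝒵) {η B C : ℝ} (hη : 0 ≤ η) (hB : 0 ≤ B) (hm : 0 < m)
    (hlip : ∀ z ∈ 𝒵, ∀ θ θ' : EncoderParams P d,
      |sampleLoss g σ ℓ θ z - sampleLoss g σ ℓ θ' z| ≤ B * ‖θ - θ'‖)
    (θ₀ : EncoderParams P d) (T : ℕ)
    (hC : ∀ S : Fin m → GraphSample d Y, (∀ i, S i ∈ 𝒵) → ∀ (ω : Fin T → Fin m), ∀ z ∈ 𝒵,
      0 ≤ sampleLoss g σ ℓ (sgd g σ ℓ η θ₀ S T ω) z ∧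
        sampleLoss g σ ℓ (sgd g σ ℓ η θ₀ S T ω) z ≤ C)
    {δ : ℝ} (hδ : 0 < δ) (hδ1 : δ < 1) :
    ENNReal.ofReal (1 - δ) ≤ Measure.pi (fun _ : Fin m => μ)
      {S | sgdExpectation (fun ω : Fin T → Fin m => risk g σ ℓ μ (sgd g σ ℓ η θ₀ S T ω)) ≤
        sgdExpectation
            (fun ω : Fin T → Fin m => empiricalRisk g σ ℓ S (sgd g σ ℓ η θ₀ S T ω)) +
          2 * η * T ^ 2 * B ^ 2 / m + (2 * (2 * η * T ^ 2 * B ^ 2) + C) *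
            √(Real.log (1 / δ) / (2 * m))} := by
  classical
  obtain ⟨s, hsμ, hs, hs𝒵⟩ := Filter.Eventually.exists_measurable_mem h𝒵
  obtain ⟨z₀, hz₀⟩ : s.Nonempty := Filter.nonempty_of_mem hsμ
  -- Stability and boundedness hold only on `𝒵`; retracting all samples to a conull measurable
  -- subset of `𝒵` makes them hold everywhere and changes the loss only on a null set.
  let r : GraphSample d Y → GraphSample d Y := s.piecewise id fun _ => z₀
  have hr : Measurable r := measurable_id.piecewise hs measurable_const
  have hr𝒵 : ∀ z, r z ∈ 𝒵 := by
    intro z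
    by_cases hz : z ∈ s
    · simpa [r, hz] using hs𝒵 z hz
    · simpa [r, hz] using hs𝒵 z₀ hz₀
  have hrs : ∀ z ∈ s, r z = z := fun z hz => by simp [r, hz]
  let L : (Fin m → GraphSample d Y) → (Fin T → Fin m) → GraphSample d Y → ℝ := fun S ω z =>
    sampleLoss g σ ℓ (sgd g σ ℓ η θ₀ (r ∘ S) T ω) (r z)
  have hL : ∀ ω, Measurable fun q : (Fin m → GraphSample d Y) × GraphSample d Y =>
      L q.1 ω q.2 := by
    intro ω
    have hrS : Measurable fun S : Fin m → GraphSample d Y => r ∘ S :=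
      measurable_pi_lambda _ fun i => hr.comp (measurable_pi_apply i)
    exact (measurable_uncurry_sampleLoss g hσ hℓm hℓ).comp
      (((measurable_sgd g hσ hℓm hℓ η θ₀ T ω).comp (hrS.comp measurable_fst)).prodMk
        (hr.comp measurable_snd))
  have hLC : ∀ S ω z, 0 ≤ L S ω z ∧ L S ω z ≤ C := fun S ω z =>
    hC _ (fun i => hr𝒵 _) ω _ (hr𝒵 z)
  have hm' : (m : ℝ) ≠ 0 := by positivity
  have hC0 : 0 ≤ C := (hLC (fun _ => z₀) (fun _ => ⟨0, hm⟩) z₀).1.trans (hLC _ _ _).2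
  have key := generalization_of_uniform_stability μ hm (fun S z => sgdExpectation fun ω => L S ω z)
    ((Finset.measurable_sum _ fun ω _ => hL ω).div_const _)
    (C := C) (β := 2 * η * T ^ 2 * B ^ 2) (by positivity) hC0
    (fun S z => (sgdExpectation_const (T := T) hm 0).symm.le.trans
      (sgdExpectation_mono fun ω => (hLC S ω z).1))
    (fun S z => (sgdExpectation_mono fun ω => (hLC S ω z).2).trans
      (sgdExpectation_const hm C).le)
    (fun S i a z => sgd_uniformly_stable hη hB hm hlip θ₀ T (fun j => hr𝒵 _) (fun j => hr𝒵 _) i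
      (fun j hj => by simp [hj]) (hr𝒵 z)) hδ hδ1
  refine key.trans (measure_mono_ae ?_)
  have hae : ∀ᵐ S ∂(Measure.pi fun _ : Fin m => μ), ∀ i, S i ∈ s :=
    ae_all_iff.2 fun i => Measure.tendsto_eval_ae_ae.eventually hsμ
  filter_upwards [hae] with S hS hle
  have hrS : r ∘ S = S := funext fun i => hrs _ (hS i)
  have hrisk : ∫ z, sgdExpectation (fun ω => L S ω z) ∂μ =
      sgdExpectation fun ω : Fin T → Fin m => risk g σ ℓ μ (sgd g σ ℓ η θ₀ S T ω) := by
    unfold sgdExpectation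
    rw [integral_div, integral_finsetSum]
    · congr 1
      refine Finset.sum_congr rfl fun ω _ => integral_congr_ae ?_
      filter_upwards [hsμ] with z hz
      simp only [L, hrS, hrs z hz]
    · intro ω _
      exact integrable_of_abs_le ((hL ω).comp (measurable_const.prodMk measurable_id))
        fun z => abs_le.2 ⟨by linarith [(hLC S ω z).1], (hLC S ω z).2⟩
  have hemp : (∑ i, sgdExpectation (fun ω => L S ω (S i))) / m =
      sgdExpectation fun ω : Fin T → Fin m => empiricalRisk g σ ℓ S (sgd g σ ℓ η θ₀ S T ω) := by
    simp only [sgdExpectation, empiricalRisk, L, hrS, hrs _ (hS _), ← Finset.sum_div]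
    rw [Finset.sum_comm, div_right_comm]
  have hle' : _ ≤ _ := hle
  rw [hrisk, hemp] at hle'
  exact hle'

/-! ### The bound -/

theorem theorem3 (T d : ℕ) (η : ℝ) (hη : 0 < η) (α_l ν_l α_s ν_s : ℝ≥0)
    (c₀ : ℝ) (hc₀ : 0 < c₀) :
    ∃ K : ℝ, 0 < K ∧
      ∀ (P N m : ℕ) (_ : 0 < m) (lam C : ℝ) (_ : c₀ ≤ N * lam ^ 2)
        (g : GraphFilter)
        (σ : ℝ → ℝ) (_ : IsLipschitzSmooth α_s ν_s σ)
        (Y : Type*) [MeasurableSpace Y]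
        (ℓ : ℝ → Y → ℝ) (_ : Measurable (Function.uncurry ℓ))
        (_ : ∀ y, IsLipschitzSmooth α_l ν_l (fun s => ℓ s y))
        (μ : MeasureTheory.Measure (GraphSample d Y)) [MeasureTheory.IsProbabilityMeasure μ]
        (𝒵 : Set (GraphSample d Y)) (_ : ∀ᵐ z ∂μ, z ∈ 𝒵)
        (_ : ∀ z ∈ 𝒵, z.size ≤ N)
        (_ : ∀ z ∈ 𝒵, g.lambdaMax z ≤ lam)
        (_ : ∀ z ∈ 𝒵, g.SignalNormalized z)
        (θ₀ : EncoderParams P d)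
        (_ : ∀ S : Fin m → GraphSample d Y, (∀ i, S i ∈ 𝒵) → ∀ (ω : Fin T → Fin m), ∀ z ∈ 𝒵,
          0 ≤ sampleLoss g σ ℓ (sgd g σ ℓ η θ₀ S T ω) z ∧
            sampleLoss g σ ℓ (sgd g σ ℓ η θ₀ S T ω) z ≤ C)
        (δ : ℝ) (_ : 0 < δ) (_ : δ < 1),
        ENNReal.ofReal (1 - δ) ≤
          MeasureTheory.Measure.pi (fun _ : Fin m => μ)
            {S | sgdExpectation (fun ω : Fin T → Fin m => risk g σ ℓ μ (sgd g σ ℓ η θ₀ S T ω)) ≤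
              sgdExpectation
                  (fun ω : Fin T → Fin m => empiricalRisk g σ ℓ S (sgd g σ ℓ η θ₀ S T ω)) +
                K * (P * (N : ℝ) ^ (T + 1) * lam ^ (2 * T)) *
                  (1 / m + √(Real.log (1 / δ) / (2 * m))) +
                C * √(Real.log (1 / δ) / (2 * m))} := by
  refine ⟨4 * η * T ^ 2 * (α_l * α_s) ^ 2 * d / c₀ ^ (T - 1) + 1, by positivity, ?_⟩
  intro P N m hm lam C hc g σ hσ Y _ ℓ hℓm hℓ μ _ 𝒵 h𝒵 hN hlam hnorm θ₀ hC δ hδ hδ1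
  obtain ⟨z₀, hz₀⟩ := h𝒵.exists
  have hlam0 : 0 ≤ lam := (g.lambdaMax_nonneg z₀).trans (hlam z₀ hz₀)
  set B : ℝ := α_l * (α_s * N * lam * √(P * d)) with hB
  refine (sgd_generalization hσ hℓm hℓ μ h𝒵 hη.le (B := B) (by positivity) hm
    (fun z hz => sampleLoss_sub_le g hσ hℓ z (hnorm z hz) (hN z hz) (hlam z hz))
    θ₀ T hC hδ hδ1).trans (MeasureTheory.measure_mono ?_)
  set W : ℝ := (4 * η * T ^ 2 * (α_l * α_s) ^ 2 * d / c₀ ^ (T - 1) + 1) *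
    (P * (N : ℝ) ^ (T + 1) * lam ^ (2 * T)) with hW
  have hBsq : B ^ 2 = (α_l * α_s) ^ 2 * d * (P * ((N : ℝ) * (N * lam ^ 2))) := by
    rw [hB]
    simp only [mul_pow, Real.sq_sqrt (by positivity : (0 : ℝ) ≤ P * d)]
    ring
  have hβW : 2 * (2 * η * T ^ 2 * B ^ 2) ≤ W := by
    rcases T with _ | t
    · have : 0 ≤ W := by positivity
      simpa using this
    · -- The surplus factor `(N * lam ^ 2) ^ t` is at least `c₀ ^ t`.
      have hpow : c₀ ^ t ≤ (N * lam ^ 2) ^ t := by gcongr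
      have hx : (N : ℝ) * lam ^ 2 ≤ (N * lam ^ 2) ^ (t + 1) / c₀ ^ t := by
        rw [le_div_iff₀ (by positivity), pow_succ' ((N : ℝ) * lam ^ 2) t]
        exact mul_le_mul_of_nonneg_left hpow (by positivity)
      calc 2 * (2 * η * ((t + 1 : ℕ) : ℝ) ^ 2 * B ^ 2)
          = 4 * η * ((t + 1 : ℕ) : ℝ) ^ 2 * (α_l * α_s) ^ 2 * d *
              (P * (N * (N * lam ^ 2))) := by rw [hBsq]; ring
        _ ≤ 4 * η * ((t + 1 : ℕ) : ℝ) ^ 2 * (α_l * α_s) ^ 2 * d *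
              (P * (N * ((N * lam ^ 2) ^ (t + 1) / c₀ ^ t))) := by gcongr
        _ = 4 * η * ((t + 1 : ℕ) : ℝ) ^ 2 * (α_l * α_s) ^ 2 * d / c₀ ^ t *
              (P * (N : ℝ) ^ (t + 1 + 1) * lam ^ (2 * (t + 1))) := by
            rw [mul_pow (N : ℝ), ← pow_mul, pow_succ (N : ℝ) (t + 1)]
            ring
        _ ≤ W := by
            rw [hW, Nat.add_sub_cancel]
            gcongr
            linarith
  have hβ0 : 0 ≤ 2 * η * T ^ 2 * B ^ 2 := by positivity
  have hβm : 2 * η * T ^ 2 * B ^ 2 / m ≤ W * (1 / m) := by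
    rw [mul_one_div]
    gcongr
    linarith
  have hβs := mul_le_mul_of_nonneg_right hβW (Real.sqrt_nonneg (Real.log (1 / δ) / (2 * m)))
  intro S hS
  simp only [Set.mem_ofPred_eq] at hS ⊢
  linarith
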